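/- **Programs.** A probabilistic control-flow graph (pCFG) $\mathcal C$ with output space $\mathbb R^m$ consists of a finite set $L$ of locations; $n \ge m$ real-valued program variables, the first $m$ of which are the output variables (we write $\mathbf x^{out}\in\mathbb R^m$ for the projection of a valuation $\mathbf x\in\mathbb R^n$); an initial location $\ell_{init}$ and valuation $\mathbf x_{init}$; a terminal location $\ell_{out}$; and finitely many transitions $\tau$, each with a source location, a probability distribution $Pr_\tau$ on successor locations, a Borel guard $G(\tau)\subseteq\mathbb R^n$, and an update which is either no update, or a deterministic assignment $x_j := u(\mathbf x)$ with $u$ Borel, or the sampling of one variable $x_j$ from a probability distribution on $\mathbb R$. The guards of the transitions leaving any location are pairwise disjoint and cover $\mathbb R^n$, and the only transition leaving $\ell_{out}$ is a self-loop with guard true and no update. Let $\mathrm{Next}(\tau,\mathbf x)$ be the random valuation obtained by applying the update of $\tau$ to $\mathbf x$. The pCFG defines a Markov process $Z_i=(\ell_i,\mathbf X_i)$, $i\ge 0$, started in $(\ell_{init},\mathbf x_{init})$: in state $(\ell,\mathbf x)$, with $\tau$ the unique enabled transition, the next location is sampled from $Pr_\tau$ and, independently, the next valuation from $\mathrm{Next}(\tau,\mathbf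 x)$. Let $\mathbb P$ be its law and $T=\inf\{i\mid \ell_i=\ell_{out}\}\in\mathbb N\cup\{\infty\}$ the termination time. $\mathcal C$ is a.s. terminating if $\mathbb P(T<\infty)=1$; its output distribution $\mu^{\mathcal C}$ is then the law of $\mathbf X_T^{out}$ on $\mathbb R^m$. A state $(\ell',\mathbf x')$ is a successor of $(\ell,\mathbf x)$ if, for the transition $\tau$ enabled at $(\ell,\mathbf x)$, $Pr_\tau(\ell')>0$ and $\mathbf x'$ is a possible result of applying the update of $\tau$ to $\mathbf x$ (for sampling from $\delta$, the possible values are the atoms of $\delta$ if $\delta$ is discrete and the points of its topological support otherwise); a run is an infinite sequence of states that starts in the initial state and in which each state is followed by one of its successors, and the reachable states are those reached from the initial state by finitely many successor steps. An invariant is a set of states $I$ that contains every reachable state; write $\mathbf x\models I(\ell)$ for $(\ell,\mathbf x)\in I$. **UESMs and LESMs.** Let $f:\mathbb R^m\to\mathbb R$ be Borel. A state function $\eta$ assigns to each location $\ell$ a Borel function $\eta(\ell,\cdot):\mathbb R^n\to\mathbb R$. A state function $U_f$ is an upper expectation supermartingale (UESM) for $f$ with respect to an invariant $I$ if $U_f(\ell_{out},\mathbf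 x)=0$ for all $\mathbf x\models I(\ell_{out})$ and, for every transition $\tau$ with source $\ell$ and every $\mathbf x\models I(\ell)\wedge G(\tau)$, with $\mathbf N=\mathrm{Next}(\tau,\mathbf x)$, $$U_f(\ell,\mathbf x)\ \ge\ \sum_{\ell'}Pr_\tau(\ell')\,\mathbb E\big[U_f(\ell',\mathbf N)+f(\mathbf N^{out})\big]-f(\mathbf x^{out}),$$ where the expectations with $Pr_\tau(\ell')>0$ are required to exist and to be finite. A lower expectation submartingale (LESM) $L_f$ is defined in the same way with $\le$ in place of $\ge$. **OST-soundness.** For a state function $\eta$ put $Y_i=\eta(Z_i)+f(\mathbf X_i^{out})$. The triple $(\mathcal C,\eta,f)$ is OST-sound if $\mathbb E|Y_i|<\infty$ for all $i\ge0$ and at least one of the following holds: (C1) $T\le c$ a.s. for some constant $c$; (C2) there is a constant $c$ with $|Y_{\min\{t,T(\rho)\}}(\rho)|\le c$ for all $t\in\mathbb N$ and all runs $\rho$; (C3) $\mathbb E[T]<\infty$, $\mathbb E|Y_0|<\infty$, and there is a constant $c$ such that $\mathbb E[|Y_{t+1}-Y_t|\mid\mathcal F_t]\le c$ a.s. for all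 $t\in\mathbb N$, where $\mathcal F_t=\sigma(Z_0,\dots,Z_t)$; (C4) there are reals $M,c_1,c_2,d$ with $c_2>0$ such that $\mathbb P(T>k)\le c_1e^{-c_2k}$ for all sufficiently large $k$, and $|Y_{k+1}-Y_k|\le M k^d$ a.s. for all $k\ge1$. **Kantorovich distance.** For a metric $d$ on $\mathbb R^m$ and probability measures $\mu_1,\mu_2$ on $\mathbb R^m$ with finite first moments with respect to $d$ (that is, for each $i$ there is $\mathbf x_0$ with $\mathbb E_{\mu_i}[d(\mathbf x_0,\cdot)]<\infty$), let $\mathcal K_d(\mu_1,\mu_2)=\sup_g|\mathbb E_{\mu_1}[g]-\mathbb E_{\mu_2}[g]|$ over all Borel $g:\mathbb R^m\to\mathbb R$ with $|g(\mathbf x)-g(\mathbf y)|\le d(\mathbf x,\mathbf y)$ for all $\mathbf x,\mathbf y$. **Theorem (Soundness of equivalence and similarity refutation).** Let $\mathcal C_1,\mathcal C_2$ be two a.s. terminating pCFGs with the same output space $\mathbb R^m$ (superscripts $1,2$ refer to them), let $f:\mathbb R^m\to\mathbb R$ be Borel, let $U_f$ be a UESM for $f$ in $\mathcal C_1$ (with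 respect to some invariant) such that $(\mathcal C_1,U_f,f)$ is OST-sound, and let $L_f$ be an LESM for $f$ in $\mathcal C_2$ (with respect to some invariant) such that $(\mathcal C_2,L_f,f)$ is OST-sound. Suppose that $$U_f(\ell^1_{init},\mathbf x^1_{init})+f((\mathbf x^1_{init})^{out})<L_f(\ell^2_{init},\mathbf x^2_{init})+f((\mathbf x^2_{init})^{out}).$$ Then $\mu^{\mathcal C_1}\ne\mu^{\mathcal C_2}$, i.e. $\mu^{\mathcal C_1}[B]\neq\mu^{\mathcal C_2}[B]$ for some Borel set $B\subseteq\mathbb R^m$. Moreover, if $d$ is a metric on $\mathbb R^m$ with respect to which $\mu^{\mathcal C_1}$ and $\mu^{\mathcal C_2}$ have finite first moments, and $f$ is $1$-Lipschitz under $d$, then $$\mathcal K_d(\mu^{\mathcal C_1},\mu^{\mathcal C_2})\ \ge\ L_f(\ell^2_{init},\mathbf x^2_{init})+f((\mathbf x^2_{init})^{out})-U_f(\ell^1_{init},\mathbf x^1_{init})-f((\mathbf x^1_{init})^{out}).$$ -/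

import Mathlib

open MeasureTheory ProbabilityTheory Filter
open scoped ENNReal

noncomputable section

/-- The update of a transition over `n` program variables: no update, the deterministic assignment
of a Borel expression to the variable `j`, or sampling of the variable `j` from a probability
distribution on `ℝ`. -/
inductive PUpdate (n : ℕ) : Type where
  | skip : PUpdate n
  | assign (j : Fin n) (u : (Fin n → ℝ) → ℝ) (hu : Measurable u) : PUpdate n
  | sample (j : Fin n) (δ : Measure ℝ) (hδ : IsProbabilityMeasure δ) : PUpdate n

namespace PUpdate

/-- The law of the random vector of successor valuations of `x`. -/
def next {n : ℕ} : PUpdate n → (Fin n → ℝ) → Measure (Fin n → ℝ)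
  | skip, x => Measure.dirac x
  | assign j u _, x => Measure.dirac (Function.update x j (u x))
  | sample j δ _, x => δ.map (fun v => Function.update x j v)

open Classical in
/-- The values that sampling from `δ` can return: the points of positive mass if `δ` is a discrete
distribution, and the topological support of `δ` otherwise. -/
def outcomes (δ : Measure ℝ) : Set ℝ :=
  if δ {v | δ {v} = 0} = 0 then {v | δ {v} ≠ 0} else δ.support

/-- The valuations that can be obtained by applying the update to `x`. -/
def results {n : ℕ} : PUpdate n → (Fin n → ℝ) → Set (Fin n → ℝ)
  | skip, x => {x}
  | assign j u _, x => {Function.update x j (u x)}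
  | sample j δ _, x => (fun v => Function.update x j v) '' outcomes δ

theorem measurable_next {n : ℕ} (up : PUpdate n) : Measurable up.next := by
  cases up with
  | skip => exact Measure.measurable_dirac
  | assign j u hu =>
    refine Measure.measurable_dirac.comp ?_
    refine measurable_pi_lambda _ fun i => ?_
    by_cases h : i = j
    · subst h
      simpa using hu
    · simpa [Function.update_of_ne h] using measurable_pi_apply i
  | sample j δ hδ =>
    have hm : Measurable fun p : (Fin n → ℝ) × ℝ => Function.update p.1 j p.2 := by
      refine measurable_pi_lambda _ fun i => ?_
      by_cases h : i = j
      · subst h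
        simpa using measurable_snd
      · simp only [Function.update_of_ne h]
        exact (measurable_pi_apply i).comp measurable_fst
    refine Measure.measurable_of_measurable_coe _ fun s hs => ?_
    have h1 : ∀ x : Fin n → ℝ, (sample j δ hδ).next x s
        = δ (Prod.mk x ⁻¹' ((fun p : (Fin n → ℝ) × ℝ => Function.update p.1 j p.2) ⁻¹' s)) := by
      intro x
      exact Measure.map_apply (measurable_update x) hs
    simp only [h1]
    exact measurable_measure_prodMk_left (hm hs)

instance isProbabilityMeasure_next {n : ℕ} (up : PUpdate n) (x : Fin n → ℝ) :
    IsProbabilityMeasure (up.next x) := by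
  cases up with
  | skip => exact Measure.dirac.isProbabilityMeasure
  | assign j u hu => exact Measure.dirac.isProbabilityMeasure
  | sample j δ hδ =>
    exact Measure.isProbabilityMeasure_map (measurable_update x).aemeasurable

end PUpdate

/-- A probabilistic control-flow graph whose output valuations range over `ℝ^m`. The program
variables are indexed by `Fin n` and the first `m` of them are the output variables. -/
structure PCFG (m : ℕ) where
  /-- locations -/
  Loc : Type
  [fintypeLoc : Fintype Loc]
  /-- number of program variables -/
  n : ℕ
  hmn : m ≤ n
  initLoc : Loc
  initVal : Fin n → ℝ
  /-- the terminal location -/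
  outLoc : Loc
  /-- (names of) transitions -/
  Trans : Type
  [fintypeTrans : Fintype Trans]
  src : Trans → Loc
  /-- the distribution of the successor location -/
  pr : Trans → PMF Loc
  guard : Trans → Set (Fin n → ℝ)
  measurableSet_guard : ∀ τ, MeasurableSet (guard τ)
  up : Trans → PUpdate n
  guard_exhaustive : ∀ ℓ x, ∃ τ, src τ = ℓ ∧ x ∈ guard τ
  guard_exclusive : ∀ τ τ', τ ≠ τ' → src τ = src τ' → Disjoint (guard τ) (guard τ')
  out_selfLoop : ∃ τ, src τ = outLoc ∧ (∀ τ', src τ' = outLoc → τ' = τ) ∧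
    pr τ = PMF.pure outLoc ∧ guard τ = Set.univ ∧ up τ = PUpdate.skip

namespace PCFG

variable {m : ℕ} (C : PCFG m)

instance : Fintype C.Loc := C.fintypeLoc
instance : Fintype C.Trans := C.fintypeTrans
instance : MeasurableSpace C.Loc := ⊤
instance : DiscreteMeasurableSpace C.Loc := ⟨fun _ => trivial⟩
instance : MeasurableSpace C.Trans := ⊤
instance : DiscreteMeasurableSpace C.Trans := ⟨fun _ => trivial⟩

/-- Variable valuations. -/
abbrev Val : Type := Fin C.n → ℝ

/-- States. -/
abbrev State : Type := C.Loc × C.Val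

/-- Infinite sequences of states. -/
abbrev Path : Type := ℕ → C.State

/-- The initial state. -/
def init : C.State := (C.initLoc, C.initVal)

/-- Projection of a valuation to the output variables. -/
def out (x : C.Val) : Fin m → ℝ := fun i => x (Fin.castLE C.hmn i)

/-- The transition `τ` is enabled at the state `s`. -/
def Enabled (τ : C.Trans) (s : C.State) : Prop := C.src τ = s.1 ∧ s.2 ∈ C.guard τ

theorem exists_enabled (s : C.State) : ∃ τ, C.Enabled τ s := C.guard_exhaustive s.1 s.2

/-- The unique transition enabled at a state. -/
def trans (s : C.State) : C.Trans := (C.exists_enabled s).choose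

theorem enabled_trans (s : C.State) : C.Enabled (C.trans s) s := (C.exists_enabled s).choose_spec

theorem enabled_iff (τ : C.Trans) (s : C.State) : C.Enabled τ s ↔ C.trans s = τ := by
  refine ⟨fun h => ?_, fun h => h ▸ C.enabled_trans s⟩
  by_contra hne
  have h' := C.enabled_trans s
  exact Set.disjoint_left.mp (C.guard_exclusive _ _ hne (h'.1.trans h.1.symm)) h'.2 h.2

/-- `s'` is a successor of `s`. -/
def IsSucc (s s' : C.State) : Prop :=
  ∃ τ, C.Enabled τ s ∧ C.pr τ s'.1 ≠ 0 ∧ s'.2 ∈ (C.up τ).results s.2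

/-- Reachable states. -/
def Reachable (s : C.State) : Prop := Relation.ReflTransGen C.IsSucc C.init s

/-- Runs. -/
def IsRun (ω : C.Path) : Prop := ω 0 = C.init ∧ ∀ i, C.IsSucc (ω i) (ω (i + 1))

theorem measurable_trans : Measurable C.trans := by
  refine measurable_to_countable' fun τ => ?_
  have h : C.trans ⁻¹' {τ} = ({C.src τ} : Set C.Loc) ×ˢ C.guard τ := by
    ext s
    rw [Set.mem_preimage, Set.mem_singleton_iff, ← C.enabled_iff τ s]
    simp [Enabled, Set.mem_prod, eq_comm]
  rw [h]
  exact (MeasurableSet.of_discrete).prod (C.measurableSet_guard τ)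

theorem measurable_transStep (τ : C.Trans) :
    Measurable fun x : C.Val => (C.pr τ).toMeasure.prod ((C.up τ).next x) := by
  let κ : Kernel C.Val C.Val := ⟨(C.up τ).next, (C.up τ).measurable_next⟩
  have : IsMarkovKernel κ := ⟨fun x => (C.up τ).isProbabilityMeasure_next x⟩
  have h : (fun x : C.Val => (C.pr τ).toMeasure.prod ((C.up τ).next x))
      = ⇑(Kernel.const C.Val (C.pr τ).toMeasure ×ₖ κ) := by
    funext x
    rw [Kernel.prod_apply, Kernel.const_apply]
    rfl
  rw [h]
  exact Kernel.measurable _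

theorem measurable_step : Measurable fun s : C.State =>
    (C.pr (C.trans s)).toMeasure.prod ((C.up (C.trans s)).next s.2) := by
  have h : Measurable fun p : C.Trans × C.Val =>
      (C.pr p.1).toMeasure.prod ((C.up p.1).next p.2) :=
    measurable_from_prod_countable_right fun τ => C.measurable_transStep τ
  have h2 : Measurable fun s : C.State => (C.trans s, s.2) :=
    C.measurable_trans.prodMk measurable_snd
  have h3 := Measurable.comp h h2
  simp only [Function.comp_def] at h3
  exact h3

/-- One step of the process: the successor location and the successor valuation are sampled
independently, according to the unique enabled transition. -/
def step : Kernel C.State C.State where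
  toFun s := (C.pr (C.trans s)).toMeasure.prod ((C.up (C.trans s)).next s.2)
  measurable' := C.measurable_step

instance : IsMarkovKernel C.step :=
  ⟨fun s => by
    change IsProbabilityMeasure ((C.pr (C.trans s)).toMeasure.prod ((C.up (C.trans s)).next s.2))
    infer_instance⟩

/-- The law of the Markov process with initial state `C.init` and transition kernel `C.step`, on the
space of all sequences of states (it is carried by the runs). -/
def pathMeasure : Measure C.Path :=
  Kernel.traj (X := fun _ => C.State)
    (fun i => C.step.comap (fun h : (j : Finset.Iic i) → C.State => h ⟨i, Finset.mem_Iic.mpr le_rfl⟩)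
      (measurable_pi_apply _)) 0 (fun _ => C.init)

instance : IsProbabilityMeasure C.pathMeasure := by
  unfold pathMeasure
  infer_instance

/-- The sequence reaches a terminal state. -/
def Terminates (ω : C.Path) : Prop := ∃ i, (ω i).1 = C.outLoc

/-- Almost-sure termination. -/
def ASTerminating : Prop := ∀ᵐ ω ∂C.pathMeasure, C.Terminates ω

/-- The termination time, `⊤` if no terminal state is reached. -/
def timeTerm (ω : C.Path) : ℕ∞ := sInf ((fun i : ℕ => (i : ℕ∞)) '' {i | (ω i).1 = C.outLoc})

/-- The output of a terminating run: the output valuation of the first terminal state (a run never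
leaves this state). -/
def output (ω : C.Path) : Fin m → ℝ := C.out (ω (C.timeTerm ω).toNat).2

theorem timeTerm_le_iff (ω : C.Path) (k : ℕ) :
    C.timeTerm ω ≤ (k : ℕ∞) ↔ ∃ i ≤ k, (ω i).1 = C.outLoc := by
  constructor
  · intro h
    have hne : ((fun i : ℕ => (i : ℕ∞)) '' {i | (ω i).1 = C.outLoc}).Nonempty := by
      by_contra hemp
      rw [Set.not_nonempty_iff_eq_empty] at hemp
      simp [timeTerm, hemp] at h
    obtain ⟨i, hi, hi'⟩ := csInf_mem hne
    refine ⟨i, ?_, hi⟩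
    have h2 : (i : ℕ∞) ≤ k := hi'.le.trans h
    exact_mod_cast h2
  · rintro ⟨i, hik, hi⟩
    have h : C.timeTerm ω ≤ (i : ℕ∞) := sInf_le (Set.mem_image_of_mem _ hi)
    exact h.trans (by exact_mod_cast hik)

theorem measurable_timeTerm : Measurable C.timeTerm := by
  have hloc : ∀ i : ℕ, MeasurableSet {ω : C.Path | (ω i).1 = C.outLoc} := fun i =>
    (measurable_fst.comp (measurable_pi_apply i)) (MeasurableSet.of_discrete (s := {C.outLoc}))
  have hle : ∀ k : ℕ, MeasurableSet {ω | C.timeTerm ω ≤ (k : ℕ∞)} := by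
    intro k
    simp only [timeTerm_le_iff, ← exists_prop, Set.ofPred_exists]
    exact MeasurableSet.iUnion fun i => MeasurableSet.iUnion fun _ => hloc i
  have hcoe : ∀ k : ℕ, MeasurableSet (C.timeTerm ⁻¹' {(k : ℕ∞)}) := by
    intro k
    have h : C.timeTerm ⁻¹' {(k : ℕ∞)} = {ω | C.timeTerm ω ≤ (k : ℕ∞)} \
        ⋃ j : ℕ, ⋃ _ : j < k, {ω | C.timeTerm ω ≤ (j : ℕ∞)} := by
      ext ω
      simp only [Set.mem_preimage, Set.mem_singleton_iff, Set.mem_sdiff, Set.mem_ofPred_eq,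
        Set.mem_iUnion, not_exists, not_le]
      constructor
      · intro h
        rw [h]
        exact ⟨le_rfl, fun j hj => by exact_mod_cast hj⟩
      · rintro ⟨h1, h2⟩
        obtain ⟨t, ht⟩ := ENat.ne_top_iff_exists.mp (ne_top_of_le_ne_top (ENat.natCast_ne_top k) h1)
        rw [← ht] at h1 h2 ⊢
        have h1' : t ≤ k := by exact_mod_cast h1
        by_contra hne
        have hlt : t < k := lt_of_le_of_ne h1' (fun h => hne (by rw [h]))
        exact lt_irrefl _ (h2 t hlt)
    rw [h]
    exact (hle k).diff (MeasurableSet.iUnion fun j => MeasurableSet.iUnion fun _ => hle j)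
  refine measurable_to_countable' fun t => ?_
  induction t using ENat.recTopCoe with
  | coe k => exact hcoe k
  | top =>
    have h : C.timeTerm ⁻¹' {⊤} = (⋃ k : ℕ, C.timeTerm ⁻¹' {(k : ℕ∞)})ᶜ := by
      ext ω
      simp only [Set.mem_preimage, Set.mem_singleton_iff, Set.mem_compl_iff, Set.mem_iUnion]
      rw [← not_iff_not, not_not, ← ne_eq, ENat.ne_top_iff_exists]
      exact exists_congr fun k => eq_comm
    rw [h]
    exact (MeasurableSet.iUnion hcoe).compl

theorem measurable_output : Measurable C.output := by
  have h : Measurable fun p : ℕ × C.Path => C.out (p.2 p.1).2 := by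
    refine measurable_from_prod_countable_right fun i => ?_
    exact measurable_pi_lambda _ fun j =>
      (measurable_pi_apply _).comp (measurable_snd.comp (measurable_pi_apply i))
  exact h.comp (((measurable_of_countable ENat.toNat).comp C.measurable_timeTerm).prodMk
    measurable_id)

/-- The output distribution: the law of the output over the terminating runs. -/
def outputDist : Measure (Fin m → ℝ) :=
  (C.pathMeasure.restrict {ω | C.Terminates ω}).map C.output

/-- State functions. -/
def IsStateFunction (η : C.Loc → C.Val → ℝ) : Prop := ∀ ℓ, Measurable (η ℓ)

/-- The predicate function `I` is an invariant. -/
def IsInvariant (I : C.Loc → Set C.Val) : Prop := ∀ s : C.State, C.Reachable s → s.2 ∈ I s.1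

/-- All the expectations `E[η(ℓ', N) + f(N^out)]`, with `N` the successor valuation of `x` under
`τ` and `ℓ'` a possible successor location, exist. -/
def HasStepExpectation (η : C.Loc → C.Val → ℝ) (f : (Fin m → ℝ) → ℝ) (τ : C.Trans) (x : C.Val) :
    Prop :=
  ∀ ℓ', C.pr τ ℓ' ≠ 0 → Integrable (fun y => η ℓ' y + f (C.out y)) ((C.up τ).next x)

/-- The sum of `Pr(ℓ') * E[η(ℓ', N) + f(N^out)]` over the successor locations `ℓ'`, with `N` the
successor valuation of `x` under `τ`. -/
def stepExpectation (η : C.Loc → C.Val → ℝ) (f : (Fin m → ℝ) → ℝ) (τ : C.Trans) (x : C.Val) : ℝ :=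
  ∑ ℓ', (C.pr τ ℓ').toReal * ∫ y, (η ℓ' y + f (C.out y)) ∂((C.up τ).next x)

/-- Upper expectation supermartingales for `f` with respect to `I`. -/
structure IsUESM (I : C.Loc → Set C.Val) (f : (Fin m → ℝ) → ℝ) (U : C.Loc → C.Val → ℝ) : Prop where
  isStateFunction : C.IsStateFunction U
  zero_on_output : ∀ x ∈ I C.outLoc, U C.outLoc x = 0
  hasStepExpectation : ∀ τ, ∀ x ∈ I (C.src τ), x ∈ C.guard τ → C.HasStepExpectation U f τ x
  expected_decrease : ∀ τ, ∀ x ∈ I (C.src τ), x ∈ C.guard τ →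
    U (C.src τ) x ≥ C.stepExpectation U f τ x - f (C.out x)

/-- Lower expectation submartingales for `f` with respect to `I`. -/
structure IsLESM (I : C.Loc → Set C.Val) (f : (Fin m → ℝ) → ℝ) (L : C.Loc → C.Val → ℝ) : Prop where
  isStateFunction : C.IsStateFunction L
  zero_on_output : ∀ x ∈ I C.outLoc, L C.outLoc x = 0
  hasStepExpectation : ∀ τ, ∀ x ∈ I (C.src τ), x ∈ C.guard τ → C.HasStepExpectation L f τ x
  expected_increase : ∀ τ, ∀ x ∈ I (C.src τ), x ∈ C.guard τ →
    L (C.src τ) x ≤ C.stepExpectation L f τ x - f (C.out x)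

/-- The process `Y_i = η(Z_i) + f(X_i^out)`, where `Z_i` is the `i`-th state and `X_i` its
valuation. -/
def proc (η : C.Loc → C.Val → ℝ) (f : (Fin m → ℝ) → ℝ) (i : ℕ) (ω : C.Path) : ℝ :=
  η (ω i).1 (ω i).2 + f (C.out (ω i).2)

/-- The termination time is almost surely bounded. -/
def CondC1 : Prop := ∃ c : ℕ, ∀ᵐ ω ∂C.pathMeasure, C.timeTerm ω ≤ (c : ℕ∞)

/-- The process is uniformly bounded up to termination. -/
def CondC2 (η : C.Loc → C.Val → ℝ) (f : (Fin m → ℝ) → ℝ) : Prop :=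
  ∃ c : ℝ, ∀ (t : ℕ) (ω : C.Path), C.IsRun ω →
    |C.proc η f (min (t : ℕ∞) (C.timeTerm ω)).toNat ω| ≤ c

/-- Finite expected termination time and uniformly bounded conditional expected steps, with respect
to the canonical filtration. -/
def CondC3 (η : C.Loc → C.Val → ℝ) (f : (Fin m → ℝ) → ℝ) : Prop :=
  (∫⁻ ω, (C.timeTerm ω : ℝ≥0∞) ∂C.pathMeasure) < ⊤ ∧
    Integrable (C.proc η f 0) C.pathMeasure ∧
    ∃ c : ℝ, ∀ t : ℕ, ∀ᵐ ω ∂C.pathMeasure,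
      (C.pathMeasure[fun ω' => |C.proc η f (t + 1) ω' - C.proc η f t ω'|
        | Filtration.piLE (X := fun _ : ℕ => C.State) t]) ω ≤ c

/-- Exponentially decreasing tails of the termination time and polynomially bounded steps. -/
def CondC4 (η : C.Loc → C.Val → ℝ) (f : (Fin m → ℝ) → ℝ) : Prop :=
  ∃ M c₁ c₂ d : ℝ, 0 < c₂ ∧
    (∀ᶠ k : ℕ in atTop,
      C.pathMeasure.real {ω | (k : ℕ∞) < C.timeTerm ω} ≤ c₁ * Real.exp (-c₂ * k)) ∧
    ∀ k : ℕ, 1 ≤ k → ∀ᵐ ω ∂C.pathMeasure,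
      |C.proc η f (k + 1) ω - C.proc η f k ω| ≤ M * (k : ℝ) ^ d

/-- OST-soundness of `(C, η, f)`. -/
def OSTSound (η : C.Loc → C.Val → ℝ) (f : (Fin m → ℝ) → ℝ) : Prop :=
  (∀ i, Integrable (C.proc η f i) C.pathMeasure) ∧
    (C.CondC1 ∨ C.CondC2 η f ∨ C.CondC3 η f ∨ C.CondC4 η f)

end PCFG

/-- Equality of output distributions on all Borel sets. -/
def OutputEquivalent {m : ℕ} (C₁ C₂ : PCFG m) : Prop :=
  ∀ B : Set (Fin m → ℝ), MeasurableSet B → C₁.outputDist B = C₂.outputDist B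

/-- `d` is a metric on `X` (not necessarily compatible with any given topology of `X`). -/
structure IsMetric {X : Type} (d : X → X → ℝ) : Prop where
  eq_iff : ∀ x y, d x y = 0 ↔ x = y
  symm : ∀ x y, d x y = d y x
  triangle : ∀ x y z, d x z ≤ d x y + d y z

/-- `f` is 1-Lipschitz under `d`. -/
def IsOneLipschitz {X : Type} (d : X → X → ℝ) (f : X → ℝ) : Prop := ∀ x y, |f x - f y| ≤ d x y

/-- `μ` has a finite first moment with respect to `d`. -/
def HasFiniteFirstMoment {X : Type} [MeasurableSpace X] (d : X → X → ℝ) (μ : Measure X) : Prop :=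
  ∃ x₀, (∫⁻ x, ENNReal.ofReal (d x₀ x) ∂μ) < ⊤

/-- The Kantorovich distance with respect to `d` of two probability measures with finite first
moments: the supremum of `|E_μ[g] - E_ν[g]|` over the (Borel) functions `g` that are 1-Lipschitz
under `d`. The set is then bounded, and all these expectations exist. -/
def kantorovich {X : Type} [MeasurableSpace X] (d : X → X → ℝ) (μ ν : Measure X) : ℝ :=
  sSup {r | ∃ g : X → ℝ, Measurable g ∧ IsOneLipschitz d g ∧ r = |∫ x, g x ∂μ - ∫ x, g x ∂ν|}

end

/-! ### Possible results of an update -/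

namespace PUpdate

/-! Write `Y i` for `C.proc η f i`, that is, `η(Z_i) + f(X_i^out)`. At invariant states the UESM
inequality says that the mean of `Y (i + 1)` given the present state is at most `Y i`, so the means
of `Y i` never exceed the initial value; for an LESM they never fall below it
(`IsUESM.integral_proc_le`, `IsLESM.le_integral_proc`). On the terminal location `η` vanishes at
reachable states, so on a terminating run `Y t` is eventually `f` of the output.

It remains to exchange limit and expectation. The terminal location is absorbing, so the process
coincides with its stopped version and optional stopping reduces to dominated convergence: each of
(C1)-(C4) yields one integrable bound for all `Y t` (`OSTSound.exists_dominating`). Hence the mean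
of `f` under the first output law is at most the value of `U`, under the second at least the value
of `L`. A strict gap separates the two laws, and a 1-Lipschitz `f` is itself a competitor in the
Kantorovich supremum.

Invariants and (C2) speak of reachable states and runs, so almost every path must be shown to be a
run (`ae_isRun`). -/

theorem measurableSet_outcomes (δ : Measure ℝ) [IsProbabilityMeasure δ] :
    MeasurableSet (outcomes δ) := by
  -- The singletons are the sections of the diagonal.
  have hm : Measurable fun v : ℝ => δ {v} := by
    have h := measurable_measure_prodMk_left (ν := δ) (measurableSet_diagonal (α := ℝ))
    convert h using 3 with v
    ext w
    simp [eq_comm]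
  unfold outcomes
  split_ifs
  · exact (hm (measurableSet_singleton 0)).compl
  · exact Measure.isClosed_support.measurableSet

theorem ae_mem_outcomes (δ : Measure ℝ) : ∀ᵐ v ∂δ, v ∈ outcomes δ := by
  unfold outcomes
  split_ifs with h
  · rw [ae_iff]
    simpa using h
  · exact Measure.support_mem_ae

/-- Joint measurability in the old and the new valuation makes the successor relation Borel. -/
theorem measurableSet_results {n : ℕ} (up : PUpdate n) :
    MeasurableSet {p : (Fin n → ℝ) × (Fin n → ℝ) | p.2 ∈ up.results p.1} := by
  have hupd (j : Fin n) {g : (Fin n → ℝ) × (Fin n → ℝ) → ℝ} (hg : Measurable g) :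
      Measurable fun p : (Fin n → ℝ) × (Fin n → ℝ) => Function.update p.1 j (g p) := by
    refine measurable_pi_lambda _ fun i => ?_
    by_cases h : i = j
    · subst h
      simpa using hg
    · simp only [Function.update_of_ne h]
      exact (measurable_pi_apply i).comp measurable_fst
  cases up with
  | skip =>
    simp only [results, Set.mem_singleton_iff]
    exact measurableSet_eq_fun measurable_snd measurable_fst
  | assign j u hu =>
    simp only [results, Set.mem_singleton_iff]
    exact measurableSet_eq_fun measurable_snd (hupd j (hu.comp measurable_fst))
  | sample j δ hδ =>
    -- `y` results from `x` iff it agrees with `x` off coordinate `j` and `y j` is a possible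
    -- outcome.
    have h : {p : (Fin n → ℝ) × (Fin n → ℝ) | p.2 ∈ (sample j δ hδ).results p.1}
        = {p | p.2 = Function.update p.1 j (p.2 j)} ∩ (fun p => p.2 j) ⁻¹' outcomes δ := by
      ext ⟨x, y⟩
      simp only [results, Set.mem_ofPred_eq, Set.mem_inter_iff, Set.mem_preimage, Set.mem_image]
      constructor
      · rintro ⟨v, hv, rfl⟩
        simpa using hv
      · rintro ⟨h1, h2⟩
        exact ⟨y j, h2, h1.symm⟩
    have hj : Measurable fun p : (Fin n → ℝ) × (Fin n → ℝ) => p.2 j :=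
      (measurable_pi_apply j).comp measurable_snd
    rw [h]
    exact (measurableSet_eq_fun measurable_snd (hupd j hj)).inter (hj (measurableSet_outcomes δ))

theorem ae_mem_results {n : ℕ} (up : PUpdate n) (x : Fin n → ℝ) :
    ∀ᵐ y ∂up.next x, y ∈ up.results x := by
  have hs : MeasurableSet {y | y ∈ up.results x} :=
    measurable_prodMk_left up.measurableSet_results
  cases up with
  | skip => exact (ae_dirac_iff hs).2 rfl
  | assign j u hu => exact (ae_dirac_iff hs).2 rfl
  | sample j δ hδ =>
    refine (ae_map_iff (measurable_update x).aemeasurable hs).2 ?_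
    filter_upwards [ae_mem_outcomes δ] with v hv
    exact ⟨v, hv, rfl⟩

end PUpdate

/-! ### The law of the process is carried by runs -/

namespace PCFG

variable {m : ℕ} (C : PCFG m)

theorem step_apply (s : C.State) :
    C.step s = (C.pr (C.trans s)).toMeasure.prod ((C.up (C.trans s)).next s.2) := rfl

theorem measurableSet_isSucc :
    MeasurableSet {p : C.State × C.State | C.IsSucc p.1 p.2} := by
  simp only [IsSucc, Set.ofPred_exists]
  refine MeasurableSet.iUnion fun τ => ?_
  have h1 : MeasurableSet {p : C.State × C.State | C.Enabled τ p.1} := by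
    simp only [C.enabled_iff]
    exact (C.measurable_trans.comp measurable_fst) (MeasurableSet.of_discrete (s := {τ}))
  have h2 : MeasurableSet {p : C.State × C.State | C.pr τ p.2.1 ≠ 0} :=
    (measurable_fst.comp measurable_snd) (MeasurableSet.of_discrete (s := {ℓ | C.pr τ ℓ ≠ 0}))
  have h3 : MeasurableSet {p : C.State × C.State | p.2.2 ∈ (C.up τ).results p.1.2} :=
    ((measurable_snd.comp measurable_fst).prodMk (measurable_snd.comp measurable_snd))
      (C.up τ).measurableSet_results
  exact h1.inter (h2.inter h3)

/-- Being a successor is a condition on the location and one on the valuation separately, so each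
can be checked on its own marginal of the product measure. -/
theorem ae_isSucc_step (s : C.State) : ∀ᵐ s' ∂C.step s, C.IsSucc s s' := by
  rw [step_apply]
  have h1 : ∀ᵐ ℓ ∂(C.pr (C.trans s)).toMeasure, C.pr (C.trans s) ℓ ≠ 0 := by
    rw [ae_iff, PMF.toMeasure_apply_eq_zero_iff _ MeasurableSet.of_discrete, Set.disjoint_left]
    intro ℓ h h'
    exact h' ((PMF.mem_support_iff _ _).1 h)
  filter_upwards [Measure.quasiMeasurePreserving_fst.ae h1,
    Measure.quasiMeasurePreserving_snd.ae ((C.up (C.trans s)).ae_mem_results s.2)] with s' h h'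
  exact ⟨C.trans s, C.enabled_trans s, h, h'⟩

/-- The law of two consecutive states. -/
theorem map_pair_pathMeasure (i : ℕ) :
    C.pathMeasure.map (fun ω => (ω i, ω (i + 1)))
      = (C.pathMeasure.map fun ω => ω i) ⊗ₘ C.step := by
  -- `κ i` depends on the history only through its last state, so the trajectory identity for the
  -- whole history projects to the last two states.
  set κ : (i : ℕ) → Kernel ((j : Finset.Iic i) → C.State) C.State := fun i =>
    C.step.comap (fun h => h ⟨i, Finset.mem_Iic.mpr le_rfl⟩) (measurable_pi_apply _)
  have h := Kernel.partialTraj_compProd_eq_map_traj (X := fun _ => C.State) (κ := κ)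
    (Nat.zero_le i) (x₀ := fun _ => C.init)
  have hmap := Kernel.traj_map_frestrictLe_apply (X := fun _ => C.State) (κ := κ) 0 i
    (fun _ => C.init)
  change C.pathMeasure.map _ = _ at hmap
  change _ = C.pathMeasure.map _ at h
  have hev : Measurable fun h : (j : Finset.Iic i) → C.State => h ⟨i, Finset.mem_Iic.mpr le_rfl⟩ :=
    measurable_pi_apply _
  have hp : Measurable fun p : ((j : Finset.Iic i) → C.State) × C.State =>
      (p.1 ⟨i, Finset.mem_Iic.mpr le_rfl⟩, p.2) := (hev.comp measurable_fst).prodMk measurable_snd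
  have hq : Measurable fun ω : C.Path =>
      (Preorder.frestrictLe (π := fun _ => C.State) i ω, ω (i + 1)) :=
    (Preorder.measurable_frestrictLe i).prodMk (measurable_pi_apply _)
  have e1 : C.pathMeasure.map (fun ω => ω i)
      = (Kernel.partialTraj (X := fun _ => C.State) κ 0 i fun _ => C.init).map
        (fun h => h ⟨i, Finset.mem_Iic.mpr le_rfl⟩) := by
    rw [← hmap, Measure.map_map hev (Preorder.measurable_frestrictLe i)]
    rfl
  have e2 : C.pathMeasure.map (fun ω => (ω i, ω (i + 1)))
      = ((Kernel.partialTraj (X := fun _ => C.State) κ 0 i fun _ => C.init) ⊗ₘ κ i).map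
        (fun p => (p.1 ⟨i, Finset.mem_Iic.mpr le_rfl⟩, p.2)) := by
    rw [h]
    exact (Measure.map_map hp hq).symm
  rw [e1, e2]
  have : IsProbabilityMeasure
      (Kernel.partialTraj (X := fun _ => C.State) κ 0 i fun _ => C.init) := by
    rw [← hmap]
    exact Measure.isProbabilityMeasure_map (Preorder.measurable_frestrictLe i).aemeasurable
  ext s hs
  rw [Measure.map_apply hp hs, Measure.compProd_apply (hp hs), Measure.compProd_apply hs,
    lintegral_map (Kernel.measurable_kernel_prodMk_left hs) hev]
  rfl

theorem ae_isSucc (i : ℕ) : ∀ᵐ ω ∂C.pathMeasure, C.IsSucc (ω i) (ω (i + 1)) := by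
  have hm : Measurable fun ω : C.Path => (ω i, ω (i + 1)) :=
    (measurable_pi_apply _).prodMk (measurable_pi_apply _)
  have h : ∀ᵐ p ∂C.pathMeasure.map (fun ω => (ω i, ω (i + 1))), C.IsSucc p.1 p.2 := by
    rw [map_pair_pathMeasure]
    exact Measure.ae_compProd_of_ae_ae C.measurableSet_isSucc (ae_of_all _ C.ae_isSucc_step)
  exact ae_of_ae_map hm.aemeasurable h

theorem ae_zero_eq_init : ∀ᵐ ω ∂C.pathMeasure, ω 0 = C.init := by
  have hmap := Kernel.traj_map_frestrictLe_apply (X := fun _ => C.State) (κ := fun i =>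
    C.step.comap (fun h : (j : Finset.Iic i) → C.State => h ⟨i, Finset.mem_Iic.mpr le_rfl⟩)
      (measurable_pi_apply _)) 0 0 (fun _ => C.init)
  change C.pathMeasure.map _ = _ at hmap
  rw [Kernel.partialTraj_self, Kernel.id_apply] at hmap
  have hev : Measurable fun h : (j : Finset.Iic 0) → C.State => h ⟨0, Finset.mem_Iic.mpr le_rfl⟩ :=
    measurable_pi_apply _
  have h : ∀ᵐ p ∂C.pathMeasure.map (Preorder.frestrictLe (π := fun _ => C.State) 0),
      p ⟨0, Finset.mem_Iic.mpr le_rfl⟩ = C.init := by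
    rw [hmap]
    exact (ae_dirac_iff (hev (measurableSet_singleton C.init))).2 rfl
  exact ae_of_ae_map (Preorder.measurable_frestrictLe 0).aemeasurable h

/-- The law of the process is carried by the runs. -/
theorem ae_isRun : ∀ᵐ ω ∂C.pathMeasure, C.IsRun ω :=
  C.ae_zero_eq_init.and (ae_all_iff.2 C.ae_isSucc)

/-! ### Absorption at the terminal location -/

variable {C}

theorem IsRun.reachable {ω : C.Path} (h : C.IsRun ω) (i : ℕ) : C.Reachable (ω i) := by
  induction i with
  | zero => rw [h.1]; exact Relation.ReflTransGen.refl
  | succ i ih => exact ih.tail (h.2 i)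

theorem IsSucc.eq_of_out {s s' : C.State} (h : C.IsSucc s s') (hs : s.1 = C.outLoc) : s' = s := by
  obtain ⟨τ, ⟨hτ, -⟩, hpr, hres⟩ := h
  obtain ⟨τ₀, -, huniq, hpr₀, -, hup₀⟩ := C.out_selfLoop
  obtain rfl := huniq τ (hτ.trans hs)
  rw [hpr₀] at hpr
  rw [hup₀] at hres
  refine Prod.ext ?_ hres
  rw [hs]
  simpa [PMF.pure_apply] using hpr

theorem IsRun.eq_of_out {ω : C.Path} (h : C.IsRun ω) {i : ℕ} (hi : (ω i).1 = C.outLoc) {j : ℕ}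
    (hij : i ≤ j) : ω j = ω i := by
  induction j, hij using Nat.le_induction with
  | base => rfl
  | succ j _ ih => rw [← ih, (h.2 j).eq_of_out (by rw [ih, hi])]

/-- Absorption turns "terminal at some time up to `k`" into a condition on the state at time `k`
alone. -/
theorem IsRun.timeTerm_le_iff {ω : C.Path} (h : C.IsRun ω) (k : ℕ) :
    C.timeTerm ω ≤ k ↔ (ω k).1 = C.outLoc := by
  rw [PCFG.timeTerm_le_iff]
  constructor
  · rintro ⟨i, hik, hi⟩
    rw [h.eq_of_out hi hik, hi]
  · exact fun hk => ⟨k, le_rfl, hk⟩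

/-- A run does not change after the termination time. -/
theorem IsRun.apply_min_timeTerm {ω : C.Path} (h : C.IsRun ω) (t : ℕ) :
    ω (min (t : ℕ∞) (C.timeTerm ω)).toNat = ω t := by
  rcases le_total (t : ℕ∞) (C.timeTerm ω) with hle | hle
  · simp [min_eq_left hle]
  · obtain ⟨k, hk⟩ := ENat.ne_top_iff_exists.1 (ne_top_of_le_ne_top (ENat.natCast_ne_top t) hle)
    rw [min_eq_right hle, ← hk, ENat.toNat_natCast]
    rw [← hk] at hle
    exact (h.eq_of_out ((h.timeTerm_le_iff k).1 hk.ge) (by exact_mod_cast hle)).symm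

/-- A run that is at the terminal location at time `t` has its final output there. -/
theorem IsRun.output_eq {ω : C.Path} (h : C.IsRun ω) {t : ℕ} (ht : (ω t).1 = C.outLoc) :
    C.output ω = C.out (ω t).2 := by
  have hle := (h.timeTerm_le_iff t).2 ht
  rw [output, ← h.apply_min_timeTerm t, min_eq_right hle]

end PCFG

/-! ### One-step expectations and monotone means -/

namespace PCFG

variable {m : ℕ} {C : PCFG m} {η : C.Loc → C.Val → ℝ} {f : (Fin m → ℝ) → ℝ}

theorem measurable_out : Measurable C.out := measurable_pi_lambda _ fun _ => measurable_pi_apply _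

theorem IsStateFunction.measurable_add (hη : C.IsStateFunction η) (hf : Measurable f) :
    Measurable fun s : C.State => η s.1 s.2 + f (C.out s.2) :=
  (measurable_from_prod_countable_right (f := fun s : C.State => η s.1 s.2) hη).add (hf.comp (measurable_out.comp measurable_snd))

/-- The step expectation is the integral against the step kernel. -/
theorem integral_step (hη : C.IsStateFunction η) (hf : Measurable f) {s : C.State}
    (hs : C.HasStepExpectation η f (C.trans s) s.2) :
    ∫ s', (η s'.1 s'.2 + f (C.out s'.2)) ∂C.step s
      = C.stepExpectation η f (C.trans s) s.2 := by
  have hint : Integrable (fun s' : C.State => η s'.1 s'.2 + f (C.out s'.2)) (C.step s) := by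
    rw [step_apply, integrable_prod_iff (hη.measurable_add hf).aestronglyMeasurable]
    -- There are finitely many locations, so only the integrals over valuations matter, and only at
    -- locations of positive probability.
    refine ⟨?_, Integrable.of_finite⟩
    rw [ae_iff, PMF.toMeasure_apply_eq_zero_iff _ MeasurableSet.of_discrete, Set.disjoint_left]
    intro ℓ h h'
    exact h' (hs ℓ ((PMF.mem_support_iff _ _).1 h))
  rw [step_apply] at hint ⊢
  rw [integral_prod _ hint, PMF.integral_eq_sum]
  rfl

/-- The expectation of the next value of the process is that of its step expectation. -/
theorem integral_proc_succ (hη : C.IsStateFunction η) (hf : Measurable f)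
    {I : C.Loc → Set C.Val} (hI : C.IsInvariant I)
    (hstep : ∀ τ, ∀ x ∈ I (C.src τ), x ∈ C.guard τ → C.HasStepExpectation η f τ x) {i : ℕ}
    (hint : Integrable (C.proc η f (i + 1)) C.pathMeasure) :
    Integrable (fun ω => C.stepExpectation η f (C.trans (ω i)) (ω i).2) C.pathMeasure ∧
      ∫ ω, C.proc η f (i + 1) ω ∂C.pathMeasure
        = ∫ ω, C.stepExpectation η f (C.trans (ω i)) (ω i).2 ∂C.pathMeasure := by
  have hi : Measurable fun ω : C.Path => ω i := measurable_pi_apply i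
  have hpair : Measurable fun ω : C.Path => (ω i, ω (i + 1)) :=
    hi.prodMk (measurable_pi_apply _)
  have : IsProbabilityMeasure (C.pathMeasure.map fun ω : C.Path => ω i) :=
    Measure.isProbabilityMeasure_map hi.aemeasurable
  have hg : Measurable fun p : C.State × C.State => η p.2.1 p.2.2 + f (C.out p.2.2) :=
    (hη.measurable_add hf).comp measurable_snd
  have hint' : Integrable (fun p : C.State × C.State => η p.2.1 p.2.2 + f (C.out p.2.2))
      ((C.pathMeasure.map fun ω : C.Path => ω i) ⊗ₘ C.step) := by
    rw [← map_pair_pathMeasure]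
    exact (integrable_map_measure hg.aestronglyMeasurable hpair.aemeasurable).2 hint
  have hinner : Integrable (fun s => ∫ s', (η s'.1 s'.2 + f (C.out s'.2)) ∂C.step s)
      (C.pathMeasure.map fun ω : C.Path => ω i) := by
    have h := Integrable.integral_compProd hint'
    simpa using h
  -- `hstep` is available only at invariant states, so the two integrands are compared along runs.
  have hae : (fun ω : C.Path => ∫ s', (η s'.1 s'.2 + f (C.out s'.2)) ∂C.step (ω i))
      =ᵐ[C.pathMeasure] fun ω => C.stepExpectation η f (C.trans (ω i)) (ω i).2 := by
    filter_upwards [C.ae_isRun] with ω hω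
    have hen := C.enabled_trans (ω i)
    refine integral_step hη hf (hstep _ _ ?_ hen.2)
    rw [hen.1]
    exact hI _ (hω.reachable i)
  constructor
  · exact ((integrable_map_measure hinner.aestronglyMeasurable hi.aemeasurable).1 hinner).congr hae
  · have h1 : ∫ ω, C.proc η f (i + 1) ω ∂C.pathMeasure
        = ∫ p, (η p.2.1 p.2.2 + f (C.out p.2.2))
          ∂((C.pathMeasure.map fun ω : C.Path => ω i) ⊗ₘ C.step) := by
      rw [← map_pair_pathMeasure, integral_map hpair.aemeasurable hg.aestronglyMeasurable]
      rfl
    rw [h1, Measure.integral_compProd hint',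
      integral_map hi.aemeasurable hinner.aestronglyMeasurable]
    exact integral_congr_ae hae

theorem integral_proc_zero :
    ∫ ω, C.proc η f 0 ω ∂C.pathMeasure = η C.initLoc C.initVal + f (C.out C.initVal) := by
  have h : C.proc η f 0 =ᵐ[C.pathMeasure]
      fun _ => η C.initLoc C.initVal + f (C.out C.initVal) := by
    filter_upwards [C.ae_zero_eq_init] with ω hω
    simp only [proc, hω, init]
  rw [integral_congr_ae h]
  simp

theorem IsUESM.integral_proc_le {I : C.Loc → Set C.Val} (hI : C.IsInvariant I)
    (hf : Measurable f) (h : C.IsUESM I f η)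
    (hint : ∀ i, Integrable (C.proc η f i) C.pathMeasure) (i : ℕ) :
    ∫ ω, C.proc η f i ω ∂C.pathMeasure ≤ η C.initLoc C.initVal + f (C.out C.initVal) := by
  induction i with
  | zero => exact integral_proc_zero.le
  | succ i ih =>
    obtain ⟨h1, h2⟩ := integral_proc_succ h.isStateFunction hf hI h.hasStepExpectation (hint (i + 1))
    refine le_trans ?_ ih
    rw [h2]
    refine integral_mono_ae h1 (hint i) ?_
    filter_upwards [C.ae_isRun] with ω hω
    have hen := C.enabled_trans (ω i)
    have := h.expected_decrease _ (ω i).2 (by rw [hen.1]; exact hI _ (hω.reachable i)) hen.2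
    rw [hen.1] at this
    simp only [proc]
    linarith

theorem IsLESM.le_integral_proc {I : C.Loc → Set C.Val} (hI : C.IsInvariant I)
    (hf : Measurable f) (h : C.IsLESM I f η)
    (hint : ∀ i, Integrable (C.proc η f i) C.pathMeasure) (i : ℕ) :
    η C.initLoc C.initVal + f (C.out C.initVal) ≤ ∫ ω, C.proc η f i ω ∂C.pathMeasure := by
  induction i with
  | zero => exact integral_proc_zero.ge
  | succ i ih =>
    obtain ⟨h1, h2⟩ := integral_proc_succ h.isStateFunction hf hI h.hasStepExpectation (hint (i + 1))
    refine le_trans ih ?_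
    rw [h2]
    refine integral_mono_ae (hint i) h1 ?_
    filter_upwards [C.ae_isRun] with ω hω
    have hen := C.enabled_trans (ω i)
    have := h.expected_increase _ (ω i).2 (by rw [hen.1]; exact hI _ (hω.reachable i)) hen.2
    rw [hen.1] at this
    simp only [proc]
    linarith

/-! ### Summable increments under (C3) and (C4) -/

/-- The process stops changing once the terminal location is reached. -/
theorem IsRun.proc_succ_eq {ω : C.Path} (h : C.IsRun ω) {t : ℕ} (ht : C.timeTerm ω ≤ t) :
    C.proc η f (t + 1) ω = C.proc η f t ω := by
  simp only [proc, h.eq_of_out ((h.timeTerm_le_iff t).1 ht) t.le_succ]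

/-- The expected size of a step of the process is collected before termination. -/
theorem integral_abs_diff_eq_setIntegral (t : ℕ) :
    ∫ ω, |C.proc η f (t + 1) ω - C.proc η f t ω| ∂C.pathMeasure
      = ∫ ω in {ω | (ω t).1 ≠ C.outLoc},
        |C.proc η f (t + 1) ω - C.proc η f t ω| ∂C.pathMeasure := by
  refine (setIntegral_eq_integral_of_ae_compl_eq_zero ?_).symm
  filter_upwards [C.ae_isRun] with ω hω hmem
  have ht : (ω t).1 = C.outLoc := by simpa using hmem
  rw [hω.proc_succ_eq ((hω.timeTerm_le_iff t).2 ht), sub_self, abs_zero]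

theorem measure_not_out_eq (t : ℕ) :
    C.pathMeasure.real {ω | (ω t).1 ≠ C.outLoc}
      = C.pathMeasure.real {ω | (t : ℕ∞) < C.timeTerm ω} := by
  refine measureReal_congr ?_
  filter_upwards [C.ae_isRun] with ω hω
  refine propext ?_
  change (ω t).1 ≠ C.outLoc ↔ (t : ℕ∞) < C.timeTerm ω
  rw [← not_le, hω.timeTerm_le_iff]

/-- This event is almost surely `{T > t}` and depends on the state at time `t` only, so conditional
expectations given the history can be integrated over it. -/
theorem measurableSet_piLE_not_out (t : ℕ) :
    MeasurableSet[Filtration.piLE (X := fun _ : ℕ => C.State) t]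
      {ω : C.Path | (ω t).1 ≠ C.outLoc} := by
  refine ⟨{h | (h ⟨t, Set.mem_Iic.2 le_rfl⟩).1 ≠ C.outLoc}, ?_, rfl⟩
  exact (measurable_fst.comp (measurable_pi_apply _))
    (MeasurableSet.of_discrete (s := {ℓ | ℓ ≠ C.outLoc}))

/-- The layer-cake formula: the tail probabilities sum to `E[T]`. Only the bound by `E[T]` is
needed. -/
theorem summable_measure_lt_timeTerm
    (h : (∫⁻ ω, (C.timeTerm ω : ℝ≥0∞) ∂C.pathMeasure) < ⊤) :
    Summable fun t : ℕ => C.pathMeasure.real {ω | (t : ℕ∞) < C.timeTerm ω} := by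
  have hms (t : ℕ) : MeasurableSet {ω | (t : ℕ∞) < C.timeTerm ω} :=
    C.measurable_timeTerm (MeasurableSet.of_discrete (s := {k | (t : ℕ∞) < k}))
  refine ENNReal.summable_toReal (ne_top_of_le_ne_top h.ne ?_)
  calc ∑' t : ℕ, C.pathMeasure {ω | (t : ℕ∞) < C.timeTerm ω}
      = ∫⁻ ω, ∑' t : ℕ, {ω | (t : ℕ∞) < C.timeTerm ω}.indicator 1 ω ∂C.pathMeasure := by
        rw [lintegral_tsum fun t => (measurable_one.indicator (hms t)).aemeasurable]
        simp only [lintegral_indicator_one (hms _)]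
    _ ≤ ∫⁻ ω, (C.timeTerm ω : ℝ≥0∞) ∂C.pathMeasure := by
        refine lintegral_mono fun ω => ?_
        simp only [Set.indicator_apply, Set.mem_ofPred_eq, Pi.one_apply]
        induction C.timeTerm ω using ENat.recTopCoe with
        | top => simp
        | coe k =>
          rw [tsum_eq_sum (s := Finset.range k) (by simp)]
          refine (Finset.sum_le_card_nsmul _ _ 1 fun t _ => by split_ifs <;> simp).trans ?_
          simp

/-- Increments vanish after termination, and `{T > t}` is known at time `t` up to a null set, so the
mean increment is at most `c * P(T > t)`. -/
theorem CondC3.summable (hint : ∀ i, Integrable (C.proc η f i) C.pathMeasure)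
    (h : C.CondC3 η f) :
    Summable fun t => ∫ ω, |C.proc η f (t + 1) ω - C.proc η f t ω| ∂C.pathMeasure := by
  obtain ⟨hT, -, c, hc⟩ := h
  refine Summable.of_nonneg_of_le (fun t => integral_nonneg fun ω => abs_nonneg _) (fun t => ?_)
    ((summable_measure_lt_timeTerm hT).mul_left c)
  have hdiff : Integrable (fun ω => |C.proc η f (t + 1) ω - C.proc η f t ω|) C.pathMeasure :=
    ((hint (t + 1)).sub (hint t)).abs
  rw [integral_abs_diff_eq_setIntegral, ← measure_not_out_eq,
    ← setIntegral_condExp ((Filtration.piLE (X := fun _ : ℕ => C.State)).le t) hdiff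
      (measurableSet_piLE_not_out t)]
  refine (setIntegral_mono_ae integrable_condExp.integrableOn (integrable_const c).integrableOn
    (hc t)).trans_eq ?_
  simp [mul_comm]

theorem summable_rpow_mul_exp_neg (d : ℝ) {c : ℝ} (hc : 0 < c) :
    Summable fun k : ℕ => (k : ℝ) ^ d * Real.exp (-c * k) := by
  -- For `k ≥ 1` the real exponent may be rounded up to a natural one; a negative `d` becomes `0`.
  refine (Real.summable_pow_mul_exp_neg_nat_mul ⌈d⌉₊ hc).of_norm_bounded_eventually_nat ?_
  filter_upwards [eventually_ge_atTop 1] with k hk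
  rw [Real.norm_of_nonneg (by positivity), ← Real.rpow_natCast]
  gcongr
  · exact_mod_cast hk
  · exact Nat.le_ceil d

/-- The mean increment is at most the polynomial step bound times `P(T > k)`, which decays
exponentially. -/
theorem CondC4.summable (hint : ∀ i, Integrable (C.proc η f i) C.pathMeasure)
    (h : C.CondC4 η f) :
    Summable fun t => ∫ ω, |C.proc η f (t + 1) ω - C.proc η f t ω| ∂C.pathMeasure := by
  obtain ⟨M, c₁, c₂, d, hc₂, htail, hdiff⟩ := h
  -- `|M|` in place of `M` keeps the factor multiplying the tail bound nonnegative.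
  refine Summable.of_norm_bounded_eventually_nat
    ((summable_rpow_mul_exp_neg d hc₂).mul_left (|M| * c₁)) ?_
  filter_upwards [htail, eventually_ge_atTop 1] with k hk hk1
  rw [Real.norm_of_nonneg (integral_nonneg fun ω => abs_nonneg _),
    integral_abs_diff_eq_setIntegral]
  calc ∫ ω in {ω | (ω k).1 ≠ C.outLoc}, |C.proc η f (k + 1) ω - C.proc η f k ω| ∂C.pathMeasure
      ≤ ∫ _ in {ω | (ω k).1 ≠ C.outLoc}, |M| * (k : ℝ) ^ d ∂C.pathMeasure := by
        refine setIntegral_mono_ae ((hint (k + 1)).sub (hint k)).abs.integrableOn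
          (integrable_const _).integrableOn ?_
        filter_upwards [hdiff k hk1] with ω hω
        exact hω.trans (mul_le_mul_of_nonneg_right (le_abs_self M) (by positivity))
    _ = |M| * (k : ℝ) ^ d * C.pathMeasure.real {ω | (k : ℕ∞) < C.timeTerm ω} := by
        rw [← measure_not_out_eq]
        simp [mul_comm]
    _ ≤ |M| * (k : ℝ) ^ d * (c₁ * Real.exp (-c₂ * k)) := by gcongr
    _ = |M| * c₁ * ((k : ℝ) ^ d * Real.exp (-c₂ * k)) := by ring

/-! ### Domination and optional stopping -/

/-- A sequence whose increments have summable `L¹` norms is dominated by an integrable function. -/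
theorem exists_dominating_of_summable {Ω : Type*} [MeasurableSpace Ω] {μ : Measure Ω}
    {Y : ℕ → Ω → ℝ} (hY : ∀ i, Integrable (Y i) μ)
    (hsum : Summable fun t => ∫ ω, |Y (t + 1) ω - Y t ω| ∂μ) :
    ∃ F : Ω → ℝ, Integrable F μ ∧ ∀ t, ∀ᵐ ω ∂μ, |Y t ω| ≤ F ω := by
  -- By telescoping, `|Y 0|` plus the total variation bounds every `|Y t|`. Working in `ℝ≥0∞`
  -- postpones convergence: Tonelli makes the integral finite, hence `G` finite a.e.
  set G : Ω → ℝ≥0∞ := fun ω => ‖Y 0 ω‖ₑ + ∑' t, ‖Y (t + 1) ω - Y t ω‖ₑ with hG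
  have hmeas (t : ℕ) : AEMeasurable (fun ω => ‖Y (t + 1) ω - Y t ω‖ₑ) μ :=
    ((hY (t + 1)).sub (hY t)).aestronglyMeasurable.enorm
  have hGm : AEMeasurable G μ :=
    (hY 0).aestronglyMeasurable.enorm.add (AEMeasurable.tsum hmeas)
  have hGint : ∫⁻ ω, G ω ∂μ ≠ ⊤ := by
    rw [lintegral_add_left' (hY 0).aestronglyMeasurable.enorm, lintegral_tsum hmeas]
    refine ENNReal.add_ne_top.2 ⟨(hY 0).2.ne, ?_⟩
    convert hsum.tsum_ofReal_ne_top using 3 with t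
    exact (ofReal_integral_norm_eq_lintegral_enorm ((hY (t + 1)).sub (hY t))).symm
  refine ⟨fun ω => (G ω).toReal, integrable_toReal_of_lintegral_ne_top hGm hGint, fun t => ?_⟩
  filter_upwards [ae_lt_top' hGm hGint] with ω hω
  have hle : ‖Y t ω‖ₑ ≤ G ω := by
    have h1 : ‖Y t ω‖ₑ ≤ ‖Y 0 ω‖ₑ + ∑ i ∈ Finset.range t, ‖Y (i + 1) ω - Y i ω‖ₑ := by
      induction t with
      | zero => simp
      | succ t ih =>
        rw [Finset.sum_range_succ, ← add_assoc]
        calc ‖Y (t + 1) ω‖ₑ = ‖Y t ω + (Y (t + 1) ω - Y t ω)‖ₑ := by rw [add_sub_cancel]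
          _ ≤ ‖Y t ω‖ₑ + ‖Y (t + 1) ω - Y t ω‖ₑ := enorm_add_le _ _
          _ ≤ _ := by gcongr
    exact h1.trans (add_le_add le_rfl (ENNReal.sum_le_tsum _))
  have := ENNReal.toReal_mono hω.ne hle
  simpa using this

/-- All four conditions serve only to produce this common bound. -/
theorem OSTSound.exists_dominating (h : C.OSTSound η f) :
    ∃ F : C.Path → ℝ, Integrable F C.pathMeasure ∧
      ∀ t, ∀ᵐ ω ∂C.pathMeasure, |C.proc η f t ω| ≤ F ω := by
  obtain ⟨hint, ⟨c, hc⟩ | ⟨c, hc⟩ | h3 | h4⟩ := h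
  -- (C1): the process is frozen from time `c` on, so the values at times `0, …, c` are all there
  -- are.
  · refine ⟨fun ω => ∑ i ∈ Finset.range (c + 1), |C.proc η f i ω|,
      integrable_finsetSum _ fun i _ => (hint i).abs, fun t => ?_⟩
    filter_upwards [hc, C.ae_isRun] with ω hω hrun
    have heq : C.proc η f t ω = C.proc η f (min t c) ω := by
      rcases le_total t c with htc | htc
      · rw [min_eq_left htc]
      · rw [min_eq_right htc]
        simp only [proc, hrun.eq_of_out ((hrun.timeTerm_le_iff c).1 hω) htc]
    rw [heq]
    exact Finset.single_le_sum (f := fun i => |C.proc η f i ω|) (fun i _ => abs_nonneg _)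
      (Finset.mem_range.2 (Nat.lt_succ_of_le (min_le_right t c)))
  -- (C2): a run is frozen after termination, so the bound at `min t T` is a bound at `t`.
  · refine ⟨fun _ => c, integrable_const c, fun t => ?_⟩
    filter_upwards [C.ae_isRun] with ω hω
    have := hc t ω hω
    simpa only [proc, hω.apply_min_timeTerm t] using this
  · exact exists_dominating_of_summable hint (h3.summable hint)
  · exact exists_dominating_of_summable hint (h4.summable hint)

theorem ASTerminating.outputDist_eq_map (hterm : C.ASTerminating) :
    C.outputDist = C.pathMeasure.map C.output := by
  rw [outputDist, Measure.restrict_eq_self_of_ae_mem (s := {ω | C.Terminates ω}) hterm]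

/-- Optional stopping: the output is integrable under `f`, and the expectations of the process
converge to the expected output. -/
theorem OSTSound.integrable_and_tendsto (h : C.OSTSound η f) (hterm : C.ASTerminating)
    {I : C.Loc → Set C.Val} (hI : C.IsInvariant I) (hf : Measurable f)
    (hout : ∀ x ∈ I C.outLoc, η C.outLoc x = 0) :
    Integrable f C.outputDist ∧
      Tendsto (fun t => ∫ ω, C.proc η f t ω ∂C.pathMeasure) atTop
        (nhds (∫ y, f y ∂C.outputDist)) := by
  obtain ⟨F, hF, hdom⟩ := h.exists_dominating
  have hlim : ∀ᵐ ω ∂C.pathMeasure,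
      Tendsto (fun t => C.proc η f t ω) atTop (nhds (f (C.output ω))) := by
    filter_upwards [hterm, C.ae_isRun] with ω ⟨i, hi⟩ hω
    -- Along a terminating run the sequence is eventually constant.
    refine tendsto_const_nhds.congr' ?_
    filter_upwards [eventually_ge_atTop i] with t hit
    have ht : (ω t).1 = C.outLoc := by rw [hω.eq_of_out hi hit, hi]
    have hmem : (ω t).2 ∈ I C.outLoc := ht ▸ hI _ (hω.reachable t)
    simp only [proc]
    rw [hω.output_eq ht, ht, hout _ hmem, zero_add]
  have hmeas : Measurable fun ω => f (C.output ω) := hf.comp C.measurable_output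
  -- The pointwise limit inherits the bound `F`.
  have hint : Integrable (fun ω => f (C.output ω)) C.pathMeasure := by
    refine hF.mono' hmeas.aestronglyMeasurable ?_
    filter_upwards [hlim, ae_all_iff.2 hdom] with ω hω hb
    exact le_of_tendsto hω.abs (Eventually.of_forall hb)
  rw [hterm.outputDist_eq_map]
  constructor
  · exact (integrable_map_measure hf.aestronglyMeasurable C.measurable_output.aemeasurable).2 hint
  · rw [integral_map C.measurable_output.aemeasurable hf.aestronglyMeasurable]
    exact tendsto_integral_of_dominated_convergence F (fun t => (h.1 t).aestronglyMeasurable) hF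
      hdom hlim

theorem ASTerminating.isProbabilityMeasure_outputDist (hterm : C.ASTerminating) :
    IsProbabilityMeasure C.outputDist := by
  rw [hterm.outputDist_eq_map]
  exact Measure.isProbabilityMeasure_map C.measurable_output.aemeasurable

theorem IsUESM.integral_outputDist_le {I : C.Loc → Set C.Val} (hI : C.IsInvariant I)
    (hf : Measurable f) (h : C.IsUESM I f η) (host : C.OSTSound η f) (hterm : C.ASTerminating) :
    ∫ y, f y ∂C.outputDist ≤ η C.initLoc C.initVal + f (C.out C.initVal) :=
  le_of_tendsto (host.integrable_and_tendsto hterm hI hf h.zero_on_output).2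
    (Eventually.of_forall (h.integral_proc_le hI hf host.1))

theorem IsLESM.le_integral_outputDist {I : C.Loc → Set C.Val} (hI : C.IsInvariant I)
    (hf : Measurable f) (h : C.IsLESM I f η) (host : C.OSTSound η f) (hterm : C.ASTerminating) :
    η C.initLoc C.initVal + f (C.out C.initVal) ≤ ∫ y, f y ∂C.outputDist :=
  ge_of_tendsto (host.integrable_and_tendsto hterm hI hf h.zero_on_output).2
    (Eventually.of_forall (h.le_integral_proc hI hf host.1))

end PCFG

/-! ### Kantorovich distance and conclusion -/

/-- The mean of a 1-Lipschitz function is close to its value at any point with finite moment. -/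
theorem IsOneLipschitz.abs_integral_sub_le {X : Type} [MeasurableSpace X] {d : X → X → ℝ}
    {g : X → ℝ} (hg : IsOneLipschitz d g) (hgm : Measurable g) {μ : Measure X}
    [IsProbabilityMeasure μ] {a : X} (ha : (∫⁻ x, ENNReal.ofReal (d a x) ∂μ) < ⊤) :
    |∫ x, g x ∂μ - g a| ≤ (∫⁻ x, ENNReal.ofReal (d a x) ∂μ).toReal := by
  have hle : ∫⁻ x, ‖g x - g a‖ₑ ∂μ ≤ ∫⁻ x, ENNReal.ofReal (d a x) ∂μ := by
    refine lintegral_mono fun x => ?_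
    rw [Real.enorm_eq_ofReal_abs, abs_sub_comm]
    exact ENNReal.ofReal_le_ofReal (hg a x)
  have hint : Integrable (fun x => g x - g a) μ :=
    ⟨(hgm.sub_const _).aestronglyMeasurable, hle.trans_lt ha⟩
  have hgint : Integrable g μ :=
    (hint.add (integrable_const (g a))).congr (ae_of_all _ fun x => sub_add_cancel _ _)
  have heq : ∫ x, g x ∂μ - g a = ∫ x, (g x - g a) ∂μ := by
    rw [integral_sub hgint (integrable_const _)]
    simp
  rw [heq, ← Real.norm_eq_abs]
  refine (norm_integral_le_lintegral_norm _).trans (ENNReal.toReal_mono ha.ne ?_)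
  simpa only [ofReal_norm] using hle

/-- The expectations of a 1-Lipschitz function differ by at most the Kantorovich distance. -/
theorem IsOneLipschitz.abs_integral_sub_integral_le_kantorovich {X : Type} [MeasurableSpace X]
    {d : X → X → ℝ} {f : X → ℝ} (hf : IsOneLipschitz d f) (hfm : Measurable f) {μ ν : Measure X}
    [IsProbabilityMeasure μ] [IsProbabilityMeasure ν] (hμ : HasFiniteFirstMoment d μ)
    (hν : HasFiniteFirstMoment d ν) :
    |∫ x, f x ∂μ - ∫ x, f x ∂ν| ≤ kantorovich d μ ν := by
  obtain ⟨a, ha⟩ := hμ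
  obtain ⟨b, hb⟩ := hν
  -- A real `sSup` is informative only for a set bounded above. The bound passes from the `μ`-mean
  -- of `g` to `g a`, then to `g b`, then to the `ν`-mean.
  refine le_csSup ⟨(∫⁻ x, ENNReal.ofReal (d a x) ∂μ).toReal + d a b
    + (∫⁻ x, ENNReal.ofReal (d b x) ∂ν).toReal, ?_⟩ ⟨f, hfm, hf, rfl⟩
  rintro _ ⟨g, hgm, hg, rfl⟩
  have h1 := abs_le.1 (hg.abs_integral_sub_le hgm ha)
  have h2 := abs_le.1 (hg.abs_integral_sub_le hgm hb)
  have h3 := abs_le.1 (hg a b)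
  rw [abs_le]
  constructor <;> linarith

theorem theorem2 {m : ℕ} (C₁ C₂ : PCFG m)
    (hterm₁ : C₁.ASTerminating) (hterm₂ : C₂.ASTerminating)
    (f : (Fin m → ℝ) → ℝ) (hf : Measurable f)
    (I₁ : C₁.Loc → Set C₁.Val) (hI₁ : C₁.IsInvariant I₁)
    (I₂ : C₂.Loc → Set C₂.Val) (hI₂ : C₂.IsInvariant I₂)
    (U : C₁.Loc → C₁.Val → ℝ) (hU : C₁.IsUESM I₁ f U) (hUost : C₁.OSTSound U f)
    (L : C₂.Loc → C₂.Val → ℝ) (hL : C₂.IsLESM I₂ f L) (hLost : C₂.OSTSound L f)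
    (hlt : U C₁.initLoc C₁.initVal + f (C₁.out C₁.initVal)
      < L C₂.initLoc C₂.initVal + f (C₂.out C₂.initVal)) :
    ¬ OutputEquivalent C₁ C₂ ∧
    ∀ d : (Fin m → ℝ) → (Fin m → ℝ) → ℝ, IsMetric d →
      HasFiniteFirstMoment d C₁.outputDist → HasFiniteFirstMoment d C₂.outputDist →
      IsOneLipschitz d f →
      kantorovich d C₁.outputDist C₂.outputDist
        ≥ L C₂.initLoc C₂.initVal + f (C₂.out C₂.initVal)
          - U C₁.initLoc C₁.initVal - f (C₁.out C₁.initVal) := by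
  have hle₁ := hU.integral_outputDist_le hI₁ hf hUost hterm₁
  have hle₂ := hL.le_integral_outputDist hI₂ hf hLost hterm₂
  have := hterm₁.isProbabilityMeasure_outputDist
  have := hterm₂.isProbabilityMeasure_outputDist
  refine ⟨fun heq => ?_, fun d _ hd₁ hd₂ hlip => ?_⟩
  -- With equal laws, a single mean of `f` would be both at most the `U`-value and at least the
  -- larger `L`-value.
  · have hmeas : C₁.outputDist = C₂.outputDist := Measure.ext heq
    rw [hmeas] at hle₁
    linarith
  · have hK := hlip.abs_integral_sub_integral_le_kantorovich hf hd₁ hd₂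
    have := neg_abs_le (∫ y, f y ∂C₁.outputDist - ∫ y, f y ∂C₂.outputDist)
    linarith
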